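/- Let $\Bbbk$ be an algebraically closed field of characteristic $p>0$, let $\theta\ge 0$ be an integer and $A=(a_{ij})\in\Bbbk^{\theta\times\theta}$ a matrix with $a_{ii}\in\{0,2\}$ for all $i$. Let $\mathfrak h$ be a $\Bbbk$-vector space of dimension $2\theta-\operatorname{rank}A$ with linearly independent families $(h_i)_{1\le i\le\theta}$ in $\mathfrak h$ and $(\xi_i)_{1\le i\le\theta}$ in $\mathfrak h^*$ such that $\xi_j(h_i)=a_{ij}$ for all $i,j$. Let $\widetilde{\mathfrak g}(A)$ be the Lie algebra over $\Bbbk$ generated by the vector space $\mathfrak h$ and elements $e_i,f_i$ ($1\le i\le\theta$) with relations $$[h,h']=0,\qquad [h,e_i]=\xi_i(h)e_i,\qquad [h,f_i]=-\xi_i(h)f_i,\qquad [e_i,f_j]=\delta_{ij}h_i\qquad(h,h'\in\mathfrak h),$$ with the $\mathbb Z$-grading in which $\deg e_i=1$, $\deg f_i=-1$, $\deg\mathfrak h=0$; let $\mathfrak r$ be the largest $\mathbb Z$-homogeneous ideal of $\widetilde{\mathfrak g}(A)$ that intersects $\mathfrak h$ trivially, and let $\mathfrak g=\mathfrak g(A)=\widetilde{\mathfrak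 g}(A)/\mathfrak r$ be the contragredient Lie algebra of $A$, in which $e_i,f_i$ also denote the images of the generators. Let $\mathsf{Rep}(\boldsymbol\alpha_p)$ be the symmetric tensor category of finite-dimensional representations of the Hopf algebra $\Bbbk[t]/(t^p)$ with $t$ primitive: its objects are the finite-dimensional vector spaces with an operator $t$ such that $t^p=0$, its morphisms are the linear maps commuting with $t$, $t$ acts on tensor products by $t\otimes 1+1\otimes t$, and the symmetry $c$ is the flip. A Lie algebra in this category is an object $X$ with a morphism $b\colon X\otimes X\to X$ such that $b\circ(\mathrm{id}+c_{X,X})=0$ and $b\circ(b\otimes\mathrm{id}_X)\circ(\mathrm{id}+(123)+(132))=0$, where the last factor acts on $X^{\otimes 3}$. If $\dim_\Bbbk\mathfrak g(A)<\infty$, then for every $1\le i\le\theta$ $$(\operatorname{ad}e_i)^p=(\operatorname{ad}f_i)^p=0 .$$ Hence $\mathfrak g$, with $t$ acting by $\operatorname{ad}e_i$ and with its Lie bracket $b(x\otimes y)=[x,y]$, is a Lie algebra $(\mathfrak g,e_i)$ in $\mathsf{Rep}(\boldsymbol\alpha_p)$. -/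

import Mathlib

open CategoryTheory MonoidalCategory
open scoped TensorProduct

universe u

noncomputable section

/-! ## Contragredient Lie algebras -/

namespace Contragredient

/-- A realization of a square matrix `A`: a vector space `𝔥` of dimension `2θ - rank A` with
linearly independent families `h i ∈ 𝔥` and `ξ i ∈ 𝔥*` such that `ξ j (h i) = A i j`. -/
structure Realization {k : Type u} [Field k] {θ : ℕ} (A : Matrix (Fin θ) (Fin θ) k)
    (𝔥 : Type u) [AddCommGroup 𝔥] [Module k 𝔥] where
  h : Fin θ → 𝔥
  ξ : Fin θ → Module.Dual k 𝔥
  finite : Module.Finite k 𝔥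
  finrank_add_rank : Module.finrank k 𝔥 + A.rank = 2 * θ
  linearIndependent_h : LinearIndependent k h
  linearIndependent_ξ : LinearIndependent k ξ
  ξ_h : ∀ i j, ξ j (h i) = A i j

/-- The generators: `e i`, `f i`, and all elements of `𝔥`. -/
inductive Generator (θ : ℕ) (𝔥 : Type u) : Type u
  | e : Fin θ → Generator θ 𝔥
  | f : Fin θ → Generator θ 𝔥
  | h : 𝔥 → Generator θ 𝔥

variable {k : Type u} [Field k] {θ : ℕ} {A : Matrix (Fin θ) (Fin θ) k}
  {𝔥 : Type u} [AddCommGroup 𝔥] [Module k 𝔥]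

namespace Free

variable (k θ 𝔥)

/-- The generator `e i` in the free Lie algebra. -/
def e (i : Fin θ) : FreeLieAlgebra k (Generator θ 𝔥) := FreeLieAlgebra.of k (Generator.e i)

/-- The generator `f i` in the free Lie algebra. -/
def f (i : Fin θ) : FreeLieAlgebra k (Generator θ 𝔥) := FreeLieAlgebra.of k (Generator.f i)

/-- The generator attached to `x ∈ 𝔥` in the free Lie algebra. -/
def h (x : 𝔥) : FreeLieAlgebra k (Generator θ 𝔥) := FreeLieAlgebra.of k (Generator.h x)

end Free

/-- The defining relators of `g̃(A)`. The relators `h_add` and `h_smul` express that the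
generators coming from the vector space `𝔥` depend linearly on its elements. -/
inductive IsRelator (R : Realization A 𝔥) : FreeLieAlgebra k (Generator θ 𝔥) → Prop
  | h_add (x y : 𝔥) :
      IsRelator R (Free.h k θ 𝔥 (x + y) - (Free.h k θ 𝔥 x + Free.h k θ 𝔥 y))
  | h_smul (c : k) (x : 𝔥) :
      IsRelator R (Free.h k θ 𝔥 (c • x) - c • Free.h k θ 𝔥 x)
  | h_h (x y : 𝔥) : IsRelator R ⁅Free.h k θ 𝔥 x, Free.h k θ 𝔥 y⁆
  | h_e (x : 𝔥) (i : Fin θ) :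
      IsRelator R (⁅Free.h k θ 𝔥 x, Free.e k θ 𝔥 i⁆ - R.ξ i x • Free.e k θ 𝔥 i)
  | h_f (x : 𝔥) (i : Fin θ) :
      IsRelator R (⁅Free.h k θ 𝔥 x, Free.f k θ 𝔥 i⁆ + R.ξ i x • Free.f k θ 𝔥 i)
  | e_f_same (i : Fin θ) :
      IsRelator R (⁅Free.e k θ 𝔥 i, Free.f k θ 𝔥 i⁆ - Free.h k θ 𝔥 (R.h i))
  | e_f_ne (i j : Fin θ) (hij : i ≠ j) : IsRelator R ⁅Free.e k θ 𝔥 i, Free.f k θ 𝔥 j⁆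

/-- The ideal of the free Lie algebra generated by the relators. -/
def relIdeal (R : Realization A 𝔥) : LieIdeal k (FreeLieAlgebra k (Generator θ 𝔥)) :=
  LieSubmodule.lieSpan k _ {x | IsRelator R x}

/-- The Lie algebra `g̃(A)`. -/
abbrev Tilde (R : Realization A 𝔥) : Type u :=
  FreeLieAlgebra k (Generator θ 𝔥) ⧸ relIdeal R

namespace Tilde

/-- The generator `e i` of `g̃(A)`. -/
def e (R : Realization A 𝔥) (i : Fin θ) : Tilde R :=
  LieSubmodule.Quotient.mk' (relIdeal R) (Free.e k θ 𝔥 i)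

/-- The generator `f i` of `g̃(A)`. -/
def f (R : Realization A 𝔥) (i : Fin θ) : Tilde R :=
  LieSubmodule.Quotient.mk' (relIdeal R) (Free.f k θ 𝔥 i)

/-- The image of `x ∈ 𝔥` in `g̃(A)`. -/
def h (R : Realization A 𝔥) (x : 𝔥) : Tilde R :=
  LieSubmodule.Quotient.mk' (relIdeal R) (Free.h k θ 𝔥 x)

/-- Iterated brackets of generators, with their total degree, where `e i` has degree `1`, `f i` has
degree `-1` and the elements of `𝔥` have degree `0`. -/
inductive IsMonomial (R : Realization A 𝔥) : ℤ → Tilde R → Prop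
  | e (i : Fin θ) : IsMonomial R 1 (e R i)
  | f (i : Fin θ) : IsMonomial R (-1) (f R i)
  | h (x : 𝔥) : IsMonomial R 0 (h R x)
  | lie {m n : ℤ} {x y : Tilde R} (hx : IsMonomial R m x) (hy : IsMonomial R n y) :
      IsMonomial R (m + n) ⁅x, y⁆

/-- The degree `n` component of the `ℤ`-grading of `g̃(A)` determined by `deg e i = 1`,
`deg f i = -1`, `deg 𝔥 = 0`. -/
def degreePart (R : Realization A 𝔥) (n : ℤ) : Submodule k (Tilde R) :=
  Submodule.span k {x | IsMonomial R n x}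

/-- The image of `𝔥` in `g̃(A)`. -/
def cartan (R : Realization A 𝔥) : Submodule k (Tilde R) :=
  Submodule.span k (Set.range (h R))

/-- An ideal is `ℤ`-homogeneous if it is the sum of its intersections with the homogeneous
components. -/
def IsHomogeneousIdeal (R : Realization A 𝔥) (I : LieIdeal k (Tilde R)) : Prop :=
  I.toSubmodule = ⨆ n : ℤ, I.toSubmodule ⊓ degreePart R n

/-- The ideal `𝔯`: the largest among the `ℤ`-homogeneous ideals that intersect `𝔥` trivially. -/
def radical (R : Realization A 𝔥) : LieIdeal k (Tilde R) :=
  sSup {I | IsHomogeneousIdeal R I ∧ I.toSubmodule ⊓ cartan R = ⊥}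

end Tilde

/-- The contragredient Lie algebra `g(A) = g̃(A) / 𝔯`. -/
abbrev LieAlg (R : Realization A 𝔥) : Type u := Tilde R ⧸ Tilde.radical R

/-- The Chevalley generator `e i` of `g(A)`. -/
def e (R : Realization A 𝔥) (i : Fin θ) : LieAlg R :=
  LieSubmodule.Quotient.mk' (Tilde.radical R) (Tilde.e R i)

/-- The Chevalley generator `f i` of `g(A)`. -/
def f (R : Realization A 𝔥) (i : Fin θ) : LieAlg R :=
  LieSubmodule.Quotient.mk' (Tilde.radical R) (Tilde.f R i)

end Contragredient

/-! ## The symmetric tensor category `Rep(α_p)` -/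

/-- A finite-dimensional representation of `α_p`, that is, of the Hopf algebra `k[t]/(t^p)` with `t`
primitive: a finite-dimensional vector space with an operator `t` such that `t ^ p = 0`. -/
structure RepAlphaP (k : Type u) [Field k] (p : ℕ) where
  carrier : Type u
  [addCommGroup : AddCommGroup carrier]
  [module : Module k carrier]
  [finite : Module.Finite k carrier]
  t : Module.End k carrier
  t_pow : t ^ p = 0

namespace RepAlphaP

attribute [instance] addCommGroup module finite

variable {k : Type u} [Field k] {p : ℕ}

/-- Morphisms of representations: linear maps that commute with `t`. -/
@[ext]
structure Hom (V W : RepAlphaP k p) where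
  lin : V.carrier →ₗ[k] W.carrier
  comm : lin ∘ₗ V.t = W.t ∘ₗ lin

instance : Category (RepAlphaP k p) where
  Hom V W := Hom V W
  id V := ⟨LinearMap.id, rfl⟩
  comp f g := ⟨g.lin ∘ₗ f.lin, by
    rw [LinearMap.comp_assoc, f.comm, ← LinearMap.comp_assoc, g.comm, LinearMap.comp_assoc]⟩

@[ext]
theorem hom_ext {V W : RepAlphaP k p} {f g : V ⟶ W} (h : f.lin = g.lin) : f = g :=
  Hom.ext h

@[simp]
theorem id_lin (V : RepAlphaP k p) : Hom.lin (𝟙 V) = LinearMap.id := rfl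

@[simp]
theorem comp_lin {U V W : RepAlphaP k p} (f : U ⟶ V) (g : V ⟶ W) :
    (f ≫ g).lin = g.lin ∘ₗ f.lin := rfl

section Preadditive

variable {V W : RepAlphaP k p}

instance : Zero (V ⟶ W) := ⟨⟨0, by simp⟩⟩

instance : Add (V ⟶ W) :=
  ⟨fun f g => ⟨f.lin + g.lin, by rw [LinearMap.add_comp, LinearMap.comp_add, f.comm, g.comm]⟩⟩

instance : Neg (V ⟶ W) :=
  ⟨fun f => ⟨-f.lin, by rw [LinearMap.neg_comp, LinearMap.comp_neg, f.comm]⟩⟩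

instance : Sub (V ⟶ W) :=
  ⟨fun f g => ⟨f.lin - g.lin, by rw [LinearMap.sub_comp, LinearMap.comp_sub, f.comm, g.comm]⟩⟩

instance : SMul ℕ (V ⟶ W) :=
  ⟨fun n f => ⟨n • f.lin, by rw [LinearMap.smul_comp, LinearMap.comp_smul, f.comm]⟩⟩

instance : SMul ℤ (V ⟶ W) :=
  ⟨fun n f => ⟨n • f.lin, by rw [LinearMap.smul_comp, LinearMap.comp_smul, f.comm]⟩⟩

@[simp]
theorem zero_lin : Hom.lin (0 : V ⟶ W) = 0 := rfl

@[simp]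
theorem add_lin (f g : V ⟶ W) : (f + g).lin = f.lin + g.lin := rfl

instance : AddCommGroup (V ⟶ W) :=
  Function.Injective.addCommGroup (fun f : V ⟶ W => f.lin) (fun _ _ h => hom_ext h) rfl
    (fun _ _ => rfl) (fun _ => rfl) (fun _ _ => rfl) (fun _ _ => rfl) (fun _ _ => rfl)

end Preadditive

instance : Preadditive (RepAlphaP k p) where
  add_comp _ _ _ f g h := hom_ext (LinearMap.comp_add f.lin g.lin h.lin)
  comp_add _ _ _ f g h := hom_ext (LinearMap.add_comp f.lin h.lin g.lin)

/-- Since `t` is primitive, it acts on a tensor product as `t ⊗ 1 + 1 ⊗ t`. -/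
def tensorT (V W : RepAlphaP k p) : Module.End k (V.carrier ⊗[k] W.carrier) :=
  V.t.rTensor W.carrier + W.t.lTensor V.carrier

theorem tensorT_tmul (V W : RepAlphaP k p) (v : V.carrier) (w : W.carrier) :
    tensorT V W (v ⊗ₜ w) = V.t v ⊗ₜ w + v ⊗ₜ W.t w := rfl

theorem map_comp_tensorT {V V' W W' : RepAlphaP k p} (f : V ⟶ V') (g : W ⟶ W') :
    TensorProduct.map f.lin g.lin ∘ₗ tensorT V W =
      tensorT V' W' ∘ₗ TensorProduct.map f.lin g.lin := by
  refine TensorProduct.ext' fun v w => ?_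
  have hf : f.lin (V.t v) = V'.t (f.lin v) := LinearMap.congr_fun f.comm v
  have hg : g.lin (W.t w) = W'.t (g.lin w) := LinearMap.congr_fun g.comm w
  simp [tensorT_tmul, hf, hg]

variable [Fact p.Prime] [CharP k p]

theorem tensorT_pow (V W : RepAlphaP k p) : tensorT V W ^ p = 0 := by
  have hc : Commute (V.t.rTensor W.carrier) (W.t.lTensor V.carrier) := by
    ext v w
    simp
  obtain ⟨r, hr⟩ := hc.exists_add_pow_prime_eq (Fact.out : p.Prime)
  have hp : ((p : ℕ) : Module.End k (V.carrier ⊗[k] W.carrier)) = 0 := by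
    rw [← map_natCast (algebraMap k (Module.End k (V.carrier ⊗[k] W.carrier))), CharP.cast_eq_zero,
      map_zero]
  rw [tensorT, hr, LinearMap.rTensor_pow, LinearMap.lTensor_pow, V.t_pow, W.t_pow, hp]
  simp

/-- The tensor product of representations. -/
def tensor (V W : RepAlphaP k p) : RepAlphaP k p where
  carrier := V.carrier ⊗[k] W.carrier
  t := tensorT V W
  t_pow := tensorT_pow V W

variable (k p) in
/-- The trivial representation, on which `t` acts as zero. -/
def unit : RepAlphaP k p where
  carrier := k
  t := 0
  t_pow := zero_pow (Fact.out : p.Prime).ne_zero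

/-- The tensor product of morphisms. -/
def tensorMap {V V' W W' : RepAlphaP k p} (f : V ⟶ V') (g : W ⟶ W') :
    tensor V W ⟶ tensor V' W' where
  lin := TensorProduct.map f.lin g.lin
  comm := map_comp_tensorT f g

/-- A linear equivalence that commutes with `t` is an isomorphism of representations. -/
def isoOfEquiv {k : Type u} [Field k] {p : ℕ} {V W : RepAlphaP k p}
    (φ : V.carrier ≃ₗ[k] W.carrier) (hφ : φ.toLinearMap ∘ₗ V.t = W.t ∘ₗ φ.toLinearMap) : V ≅ W where
  hom := ⟨φ.toLinearMap, hφ⟩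
  inv := ⟨φ.symm.toLinearMap, by
    ext w
    have h := LinearMap.congr_fun hφ (φ.symm w)
    apply φ.injective
    simpa using h.symm⟩
  hom_inv_id := hom_ext (by ext x; simp)
  inv_hom_id := hom_ext (by ext x; simp)

/-- The associativity constraint `(u ⊗ v) ⊗ w ↦ u ⊗ (v ⊗ w)`. -/
def assocIso (U V W : RepAlphaP k p) : tensor (tensor U V) W ≅ tensor U (tensor V W) :=
  isoOfEquiv (TensorProduct.assoc k U.carrier V.carrier W.carrier)
    (TensorProduct.ext_threefold fun u v w => by
      change TensorProduct.assoc k U.carrier V.carrier W.carrier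
          ((U.t u ⊗ₜ[k] v + u ⊗ₜ[k] V.t v) ⊗ₜ[k] w + (u ⊗ₜ[k] v) ⊗ₜ[k] W.t w) =
        U.t u ⊗ₜ[k] (v ⊗ₜ[k] w) + u ⊗ₜ[k] (V.t v ⊗ₜ[k] w + v ⊗ₜ[k] W.t w)
      simp [TensorProduct.add_tmul, TensorProduct.tmul_add, add_assoc])

/-- The left unit constraint `c ⊗ v ↦ c • v`. -/
def leftUnitIso (V : RepAlphaP k p) : tensor (unit k p) V ≅ V :=
  isoOfEquiv (TensorProduct.lid k V.carrier)
    (TensorProduct.ext' fun (c : k) v => by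
      change TensorProduct.lid k V.carrier ((0 : k) ⊗ₜ[k] v + c ⊗ₜ[k] V.t v) = V.t (c • v)
      simp)

/-- The right unit constraint `v ⊗ c ↦ c • v`. -/
def rightUnitIso (V : RepAlphaP k p) : tensor V (unit k p) ≅ V :=
  isoOfEquiv (TensorProduct.rid k V.carrier)
    (TensorProduct.ext' fun v (c : k) => by
      change TensorProduct.rid k V.carrier (V.t v ⊗ₜ[k] c + v ⊗ₜ[k] (0 : k)) = V.t (c • v)
      simp)

/-- The symmetry `v ⊗ w ↦ w ⊗ v`. -/
def swapIso (V W : RepAlphaP k p) : tensor V W ≅ tensor W V :=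
  isoOfEquiv (TensorProduct.comm k V.carrier W.carrier)
    (TensorProduct.ext' fun v w => by
      change TensorProduct.comm k V.carrier W.carrier (V.t v ⊗ₜ[k] w + v ⊗ₜ[k] W.t w) =
        W.t w ⊗ₜ[k] v + w ⊗ₜ[k] V.t v
      simp [add_comm])

instance : MonoidalCategoryStruct (RepAlphaP k p) where
  tensorObj V W := tensor V W
  whiskerLeft V _ _ f := tensorMap (𝟙 V) f
  whiskerRight f W := tensorMap f (𝟙 W)
  tensorHom f g := tensorMap f g
  tensorUnit := unit k p
  associator := assocIso
  leftUnitor := leftUnitIso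
  rightUnitor := rightUnitIso

theorem tensorHom_lin {V V' W W' : RepAlphaP k p} (f : V ⟶ V') (g : W ⟶ W') :
    (f ⊗ₘ g).lin = TensorProduct.map f.lin g.lin := rfl

instance : MonoidalCategory (RepAlphaP k p) :=
  MonoidalCategory.ofTensorHom
    (id_tensorHom_id := fun _ _ => hom_ext TensorProduct.map_id)
    (id_tensorHom := fun _ _ _ _ => rfl)
    (tensorHom_id := fun _ _ => rfl)
    (tensorHom_comp_tensorHom := fun f₁ f₂ g₁ g₂ =>
      hom_ext (TensorProduct.map_comp g₁.lin g₂.lin f₁.lin f₂.lin).symm)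
    (associator_naturality := fun _ _ _ =>
      hom_ext (TensorProduct.ext_threefold fun _ _ _ => rfl))
    (leftUnitor_naturality := fun f =>
      hom_ext (TensorProduct.ext' fun (c : k) v => (f.lin.map_smul c v).symm))
    (rightUnitor_naturality := fun f =>
      hom_ext (TensorProduct.ext' fun v (c : k) => (f.lin.map_smul c v).symm))
    (pentagon := fun _ _ _ _ =>
      hom_ext (TensorProduct.ext_fourfold fun _ _ _ _ => rfl))
    (triangle := fun _ _ => hom_ext (TensorProduct.ext_threefold fun v (c : k) w =>
      (TensorProduct.smul_tmul c v w).symm))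

instance : SymmetricCategory (RepAlphaP k p) where
  braiding V W := swapIso V W
  braiding_naturality_right _ _ _ _ := hom_ext (TensorProduct.ext' fun _ _ => rfl)
  braiding_naturality_left _ _ := hom_ext (TensorProduct.ext' fun _ _ => rfl)
  hexagon_forward _ _ _ := hom_ext (TensorProduct.ext_threefold fun _ _ _ => rfl)
  hexagon_reverse U V W := hom_ext (by
    refine TensorProduct.ext (LinearMap.ext fun u => ?_)
    exact TensorProduct.ext' fun v w => rfl)
  symmetry _ _ := hom_ext (TensorProduct.ext' fun _ _ => rfl)

/-- The pair `(g, x)`: the representation of `α_p` on a finite-dimensional Lie algebra `g` on which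
`t` acts as `ad x`, where `(ad x) ^ p = 0`. -/
abbrev ofInner {k : Type u} [Field k] {p : ℕ} (g : Type u) [LieRing g] [LieAlgebra k g]
    [Module.Finite k g] (x : g) (hx : LieAlgebra.ad k g x ^ p = 0) : RepAlphaP k p where
  carrier := g
  t := LieAlgebra.ad k g x
  t_pow := hx

end RepAlphaP

/-! ## Lie algebras in symmetric monoidal categories -/

/-- The cyclic permutation `x ⊗ y ⊗ z ↦ y ⊗ z ⊗ x` of the threefold tensor power of `X`. -/
def cyclicPerm {C : Type*} [Category C] [MonoidalCategory C] [SymmetricCategory C] (X : C) :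
    (X ⊗ X) ⊗ X ⟶ (X ⊗ X) ⊗ X :=
  (α_ X X X).hom ≫ (β_ X (X ⊗ X)).hom

/-- The morphism `b : X ⊗ X ⟶ X` is the bracket of an (operadic) Lie algebra in `C`: it satisfies
the anti-symmetry and Jacobi identities. -/
structure IsLieBracket {C : Type*} [Category C] [Preadditive C] [MonoidalCategory C]
    [SymmetricCategory C] (X : C) (b : X ⊗ X ⟶ X) : Prop where
  antisymm : (𝟙 (X ⊗ X) + (β_ X X).hom) ≫ b = 0
  jacobi : (𝟙 ((X ⊗ X) ⊗ X) + cyclicPerm X + cyclicPerm X ≫ cyclicPerm X) ≫ (b ▷ X) ≫ b = 0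

end

/-! In characteristic `p` the operator `D = (ad e_i)^p` is a derivation of `g̃(A)`, because the
middle binomial coefficients vanish. The relations give `D(𝔥) = 0` and `D(f_j) = 0`; for `p = 2` the
latter uses that `a_ii ∈ {0, 2}` is zero in `k`. Applying `D` to `[f_l, e_j] ∈ 𝔥` then shows that
`D(e_j)` commutes with every `f_l`.

Such an element of positive degree generates an ideal living in positive degrees: bracketing with
`e`'s and `𝔥` already gives a subspace stable under the `f`'s. This homogeneous ideal misses `𝔥`, so
`D(e_j) ∈ 𝔯` (`mem_radical_of_lie_eq_zero`). As `D` is a derivation and `𝔯` an ideal, `D⁻¹(𝔯)` is a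
subalgebra; it contains the generators, so `D` maps `g̃(A)` into `𝔯` and vanishes on `g(A)`.

The families `a`, `b` and the sign `ε` below treat `e` and `f` at once. The bracket is a morphism in
`Rep(α_p)` because `ad e_i` is a derivation. -/

namespace Contragredient

variable {k : Type u} [Field k] {θ : ℕ} {A : Matrix (Fin θ) (Fin θ) k}
  {𝔥 : Type u} [AddCommGroup 𝔥] [Module k 𝔥]

/-- In characteristic `p`, the `p`-th power of an inner derivation is a derivation. -/
theorem ad_pow_char_lie {L : Type*} [LieRing L] [LieAlgebra k L] (p : ℕ) [Fact p.Prime] [CharP k p]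
    (x y z : L) :
    (LieAlgebra.ad k L x ^ p) ⁅y, z⁆ =
      ⁅(LieAlgebra.ad k L x ^ p) y, z⁆ + ⁅y, (LieAlgebra.ad k L x ^ p) z⁆ := by
  have hp : p.Prime := Fact.out
  rw [LieAlgebra.ad_pow_lie, Finset.Nat.sum_antidiagonal_eq_sum_range_succ_mk,
    Finset.sum_range_succ, Finset.sum_range_eq_add_Ico _ hp.pos, Finset.sum_eq_zero]
  · simp [add_comm]
  · intro j hj
    rw [Finset.mem_Ico] at hj
    obtain ⟨m, hm⟩ := hp.dvd_choose_self (by omega : j ≠ 0) hj.2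
    simp only
    rw [hm, ← Nat.cast_smul_eq_nsmul k, Nat.cast_mul, CharP.cast_eq_zero, zero_mul, zero_smul]

/-- The quotient map by an ideal as a morphism of Lie algebras. -/
def quotientHom {L : Type*} [LieRing L] [LieAlgebra k L] (I : LieIdeal k L) : L →ₗ⁅k⁆ L ⧸ I :=
  { (LieSubmodule.Quotient.mk' I : L →ₗ[k] L ⧸ I) with map_lie' := rfl }

/-! ### Relations and generation in `g̃(A)`. -/

namespace Tilde

variable (R : Realization A 𝔥)

theorem mk_eq_zero_of_isRelator {x : FreeLieAlgebra k (Generator θ 𝔥)} (hx : IsRelator R x) :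
    quotientHom (relIdeal R) x = 0 :=
  (LieSubmodule.Quotient.mk_eq_zero (N := relIdeal R)).2 (LieSubmodule.subset_lieSpan hx)

theorem lie_h_h (x y : 𝔥) : ⁅h R x, h R y⁆ = 0 :=
  mk_eq_zero_of_isRelator R (.h_h x y)

theorem lie_h_e (x : 𝔥) (i : Fin θ) : ⁅h R x, e R i⁆ = R.ξ i x • e R i :=
  sub_eq_zero.1 (mk_eq_zero_of_isRelator R (.h_e x i))

theorem lie_h_f (x : 𝔥) (i : Fin θ) : ⁅h R x, f R i⁆ = -R.ξ i x • f R i := by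
  rw [neg_smul]
  exact eq_neg_of_add_eq_zero_left (mk_eq_zero_of_isRelator R (.h_f x i))

theorem lie_e_f_same (i : Fin θ) : ⁅e R i, f R i⁆ = h R (R.h i) :=
  sub_eq_zero.1 (mk_eq_zero_of_isRelator R (.e_f_same i))

theorem lie_e_f_ne {i j : Fin θ} (hij : i ≠ j) : ⁅e R i, f R j⁆ = 0 :=
  mk_eq_zero_of_isRelator R (.e_f_ne i j hij)

theorem h_add (x y : 𝔥) : h R (x + y) = h R x + h R y :=
  sub_eq_zero.1 (mk_eq_zero_of_isRelator R (.h_add x y))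

theorem h_smul (c : k) (x : 𝔥) : h R (c • x) = c • h R x :=
  sub_eq_zero.1 (mk_eq_zero_of_isRelator R (.h_smul c x))

theorem h_neg (x : 𝔥) : h R (-x) = -h R x := by
  rw [← neg_one_smul k, h_smul, neg_one_smul]

variable {R}

/-- A subalgebra of `g̃(A)` that contains the generators is everything. -/
theorem subalgebra_eq_top (S : LieSubalgebra k (Tilde R)) (he : ∀ i, e R i ∈ S)
    (hf : ∀ i, f R i ∈ S) (hh : ∀ x, h R x ∈ S) : S = ⊤ := by
  let φ : FreeLieAlgebra k (Generator θ 𝔥) →ₗ⁅k⁆ S := FreeLieAlgebra.lift k fun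
    | .e i => ⟨e R i, he i⟩
    | .f i => ⟨f R i, hf i⟩
    | .h x => ⟨h R x, hh x⟩
  -- The quotient map factors through `S`, and it is surjective.
  have hφ : S.incl.comp φ = quotientHom (relIdeal R) := by
    ext x
    cases x <;> simp [φ] <;> rfl
  refine eq_top_iff.2 fun y _ => ?_
  obtain ⟨x, rfl⟩ := LieSubmodule.Quotient.surjective_mk' (relIdeal R) y
  change quotientHom (relIdeal R) x ∈ S
  rw [← hφ]
  exact (φ x).2

/-- A subspace that is stable under the adjoint action of the generators is an ideal. -/
theorem lie_mem_of_generators (N : Submodule k (Tilde R)) (he : ∀ i, ∀ y ∈ N, ⁅e R i, y⁆ ∈ N)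
    (hf : ∀ i, ∀ y ∈ N, ⁅f R i, y⁆ ∈ N) (hh : ∀ x, ∀ y ∈ N, ⁅h R x, y⁆ ∈ N) (z : Tilde R)
    {y : Tilde R} (hy : y ∈ N) : ⁅z, y⁆ ∈ N := by
  let S : LieSubalgebra k (Tilde R) :=
    { carrier := {z | ∀ y ∈ N, ⁅z, y⁆ ∈ N}
      add_mem' := fun ha hb y hy => by rw [add_lie]; exact N.add_mem (ha y hy) (hb y hy)
      zero_mem' := fun y _ => by rw [zero_lie]; exact N.zero_mem
      smul_mem' := fun c a ha y hy => by rw [smul_lie]; exact N.smul_mem c (ha y hy)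
      lie_mem' := fun {a b} ha hb y hy => by
        change ⁅⁅a, b⁆, y⁆ ∈ N
        rw [lie_lie]
        exact N.sub_mem (ha _ (hb y hy)) (hb _ (ha y hy)) }
  have hS : S = ⊤ := subalgebra_eq_top S he hf hh
  have hz : z ∈ S := hS ▸ LieSubalgebra.mem_top z
  exact hz y hy

/-! ### Separating degree zero from the other degrees. -/

variable (R) in
/-- For `c ≠ 0` there is an endomorphism of `g̃(A)` that scales the degree `n` component by
`c ^ n`. -/
theorem exists_torus_action (c : k) (hc : c ≠ 0) :
    ∃ φ : Module.End k (Tilde R), ∀ n : ℤ, degreePart R n ≤ φ.eigenspace (c ^ n) := by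
  let ψ : FreeLieAlgebra k (Generator θ 𝔥) →ₗ⁅k⁆ Tilde R := FreeLieAlgebra.lift k fun
    | .e i => c • e R i
    | .f i => c⁻¹ • f R i
    | .h x => h R x
  have ψe (i : Fin θ) : ψ (Free.e k θ 𝔥 i) = c • e R i := by simp [ψ, Free.e]
  have ψf (i : Fin θ) : ψ (Free.f k θ 𝔥 i) = c⁻¹ • f R i := by simp [ψ, Free.f]
  have ψh (x : 𝔥) : ψ (Free.h k θ 𝔥 x) = h R x := by simp [ψ, Free.h]
  -- Every relator is homogeneous; in `[e_i, f_i] = h_i` the scalars `c` and `c⁻¹` cancel.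
  have hψ : relIdeal R ≤ ψ.ker := by
    refine LieSubmodule.lieSpan_le.2 fun x hx => ?_
    rw [SetLike.mem_coe, LieHom.mem_ker]
    cases hx with
    | h_add x y => simp [ψh, h_add]
    | h_smul c x => simp [ψh, h_smul]
    | h_h x y => simp [ψh, lie_h_h]
    | h_e x i => simp [ψh, ψe, lie_h_e, smul_comm c]
    | h_f x i => simp [ψh, ψf, lie_h_f, smul_comm c⁻¹]
    | e_f_same i => simp [ψh, ψe, ψf, lie_e_f_same, hc]
    | e_f_ne i j hij => simp [ψe, ψf, lie_e_f_ne R hij]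
  let φ : Module.End k (Tilde R) := (relIdeal R).toSubmodule.liftQ
    (ψ : FreeLieAlgebra k (Generator θ 𝔥) →ₗ[k] Tilde R) fun x hx => ψ.mem_ker.1 (hψ hx)
  have φmk (x) : φ (LieSubmodule.Quotient.mk' (relIdeal R) x) = ψ x := rfl
  have φlie (x y : Tilde R) : φ ⁅x, y⁆ = ⁅φ x, φ y⁆ := by
    obtain ⟨x, rfl⟩ := LieSubmodule.Quotient.surjective_mk' (relIdeal R) x
    obtain ⟨y, rfl⟩ := LieSubmodule.Quotient.surjective_mk' (relIdeal R) y
    exact ψ.map_lie x y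
  refine ⟨φ, fun n => Submodule.span_le.2 fun x hx => ?_⟩
  rw [SetLike.mem_coe, Module.End.mem_eigenspace_iff]
  induction hx with
  | e i => rw [e, φmk, ψe, zpow_one]; rfl
  | f i => rw [f, φmk, ψf, zpow_neg_one]; rfl
  | h x => rw [h, φmk, ψh, zpow_zero, one_smul]; rfl
  | lie _ _ hx hy => rw [φlie, hx, hy, zpow_add₀ hc, smul_lie, lie_smul, smul_smul]

theorem cartan_le_degreePart : cartan R ≤ degreePart R 0 := by
  refine Submodule.span_mono ?_
  rintro _ ⟨x, rfl⟩
  exact .h x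

/-- In an infinite field there is a nonzero element that is not killed by given nonzero
exponents. -/
theorem exists_zpow_ne_one {k : Type*} [Field k] [Infinite k] (s : Finset {n : ℤ // n ≠ 0}) :
    ∃ c : k, c ≠ 0 ∧ ∀ n ∈ s, c ^ (n : ℤ) ≠ 1 := by
  -- A non-root is the desired `c`: the factor `X` forces `c ≠ 0`, and `c ^ n = 1` is equivalent to
  -- `c ^ |n| = 1`.
  let P : Polynomial k := Polynomial.X * ∏ n ∈ s, (Polynomial.X ^ n.1.natAbs - Polynomial.C 1)
  have hP : P ≠ 0 := mul_ne_zero Polynomial.X_ne_zero <| Finset.prod_ne_zero_iff.2 fun n _ =>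
    Polynomial.X_pow_sub_C_ne_zero (Int.natAbs_pos.2 n.2) 1
  obtain ⟨c, hc⟩ : ∃ c, P.eval c ≠ 0 := by
    by_contra! h
    exact hP (Polynomial.funext fun r => by simp [h r])
  simp only [P, Polynomial.eval_mul, Polynomial.eval_X, Polynomial.eval_prod, mul_ne_zero_iff,
    Finset.prod_ne_zero_iff] at hc
  refine ⟨c, hc.1, fun n hn h => hc.2 n hn ?_⟩
  have : c ^ n.1.natAbs = 1 := by
    rcases Int.natAbs_eq n.1 with h' | h' <;> rw [h'] at h
    · rwa [zpow_natCast] at h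
    · rwa [zpow_neg, inv_eq_one, zpow_natCast] at h
  simp [this]

/-- The sum of the components of nonzero degree meets `𝔥` trivially. -/
theorem iSup_degreePart_inf_cartan [Infinite k] :
    (⨆ n : {n : ℤ // n ≠ 0}, degreePart R n) ⊓ cartan R = ⊥ := by
  refine eq_bot_iff.2 fun y hy => ?_
  obtain ⟨hy, hy₀⟩ := Submodule.mem_inf.1 hy
  -- Only finitely many degrees occur in `y`, so one `c` gives all of them eigenvalues different
  -- from `1`, the eigenvalue on `𝔥`.
  obtain ⟨s, hs⟩ := Submodule.mem_iSup_iff_exists_finset.1 hy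
  obtain ⟨c, hc, hcs⟩ := exists_zpow_ne_one (k := k) s
  obtain ⟨φ, hφ⟩ := exists_torus_action R c hc
  have h₁ : y ∈ φ.eigenspace 1 := by
    simpa using hφ 0 (cartan_le_degreePart hy₀)
  have h₂ : (⨆ n ∈ s, degreePart R n) ≤ ⨆ (μ : k) (_ : μ ≠ 1), φ.eigenspace μ :=
    iSup₂_le fun n hn => (hφ n).trans (le_iSup₂_of_le _ (hcs n hn) le_rfl)
  exact (Submodule.disjoint_def.1 (φ.eigenspaces_iSupIndep 1)) y h₁ (h₂ hs)

/-! ### Ideals generated by extremal elements. -/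

/-- The descendants of `x` under the operators `ad (a i)`, which have degree `ε`, and `ad 𝔥`,
together with their degrees. -/
inductive IsDescendant (R : Realization A 𝔥) (a : Fin θ → Tilde R) (ε : ℤ) (x : Tilde R) (m : ℤ) :
    ℤ → Tilde R → Prop
  | base : IsDescendant R a ε x m m x
  | lie {n : ℤ} {y : Tilde R} (i : Fin θ) (hy : IsDescendant R a ε x m n y) :
      IsDescendant R a ε x m (ε + n) ⁅a i, y⁆
  | lie_h {n : ℤ} {y : Tilde R} (z : 𝔥) (hy : IsDescendant R a ε x m n y) :
      IsDescendant R a ε x m (0 + n) ⁅h R z, y⁆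

/-- A monomial whose degree has the same sign as that of the `a i` and that commutes with the
opposite generators `b i` lies in the radical. -/
theorem mem_radical_of_lie_eq_zero [Infinite k] {a b : Fin θ → Tilde R} {ε : ℤ}
    (ha : ∀ i, IsMonomial R ε (a i))
    (hab : (∀ i, e R i = a i ∧ f R i = b i) ∨ (∀ i, e R i = b i ∧ f R i = a i))
    (hba : ∀ i j, ∃ z, ⁅b j, a i⁆ = h R z) (hbh : ∀ z j, ∃ c : k, ⁅b j, h R z⁆ = c • b j)
    {m : ℤ} {x : Tilde R} (hx : IsMonomial R m x) (hm : 0 < ε * m) (hbx : ∀ j, ⁅b j, x⁆ = 0) :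
    x ∈ radical R := by
  let N : Submodule k (Tilde R) := Submodule.span k {y | ∃ n, IsDescendant R a ε x m n y}
  have hN {z : Tilde R} (hz : ∀ n y, IsDescendant R a ε x m n y → ⁅z, y⁆ ∈ N) :
      ∀ y ∈ N, ⁅z, y⁆ ∈ N := fun y hy =>
    (Submodule.span_le.2 fun y ⟨n, hy⟩ => hz n y hy :
      N ≤ N.comap (LieAlgebra.ad k (Tilde R) z)) hy
  have hNa (i) : ∀ y ∈ N, ⁅a i, y⁆ ∈ N := hN fun n y hy => Submodule.subset_span ⟨_, hy.lie i⟩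
  have hNh (z) : ∀ y ∈ N, ⁅h R z, y⁆ ∈ N := hN fun n y hy => Submodule.subset_span ⟨_, hy.lie_h z⟩
  -- Move `b j` inward by the Jacobi identity: each commutator with `a i` or `𝔥` lies in `𝔥` or is a
  -- multiple of `b j`, and `b j` finally kills `x`.
  have hNb (j) : ∀ y ∈ N, ⁅b j, y⁆ ∈ N := hN fun n y hy => by
    induction hy with
    | base => rw [hbx]; exact N.zero_mem
    | @lie n y i hy ih =>
      obtain ⟨z, hz⟩ := hba i j
      rw [leibniz_lie, hz]
      exact N.add_mem (hNh _ _ (Submodule.subset_span ⟨_, hy⟩)) (hNa _ _ ih)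
    | @lie_h n y z hy ih =>
      obtain ⟨c, hc⟩ := hbh z j
      rw [leibniz_lie, hc, smul_lie]
      exact N.add_mem (N.smul_mem _ ih) (hNh _ _ ih)
  have hNlie (z : Tilde R) {y : Tilde R} (hy : y ∈ N) : ⁅z, y⁆ ∈ N := by
    refine lie_mem_of_generators N ?_ ?_ hNh z hy <;> intro i <;> rcases hab with h | h <;>
      simpa only [(h i).1, (h i).2] using by first | exact hNa i | exact hNb i
  have hmon {n y} (hy : IsDescendant R a ε x m n y) : IsMonomial R n y ∧ 0 < ε * n := by
    induction hy with
    | base => exact ⟨hx, hm⟩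
    | lie i _ ih => exact ⟨(ha i).lie ih.1, by nlinarith [ih.2, mul_self_nonneg ε]⟩
    | lie_h z _ ih => exact ⟨(IsMonomial.h z).lie ih.1, by simpa using ih.2⟩
  let J : LieIdeal k (Tilde R) := { N with lie_mem := fun {z y} hy => hNlie z hy }
  have hJ : J.toSubmodule = N := rfl
  have hhom : IsHomogeneousIdeal R J := by
    refine le_antisymm ?_ (iSup_le fun n => inf_le_left)
    rw [hJ]
    refine Submodule.span_le.2 fun y ⟨n, hy⟩ => Submodule.mem_iSup_of_mem n ?_
    exact ⟨Submodule.subset_span ⟨n, hy⟩, Submodule.subset_span (hmon hy).1⟩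
  have hcartan : J.toSubmodule ⊓ cartan R = ⊥ := by
    rw [eq_bot_iff, ← iSup_degreePart_inf_cartan (R := R), hJ]
    refine inf_le_inf_right _ (Submodule.span_le.2 fun y ⟨n, hy⟩ => ?_)
    have hn : n ≠ 0 := by
      rintro rfl
      simpa using (hmon hy).2
    exact Submodule.mem_iSup_of_mem ⟨n, hn⟩ (Submodule.subset_span (hmon hy).1)
  exact (le_sSup ⟨hhom, hcartan⟩ : J ≤ radical R)
    (Submodule.subset_span ⟨m, IsDescendant.base⟩ : x ∈ N)

/-! ### The `p`-th power of `ad` of a generator. -/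

/-- Iterating `ad x` on a monomial gives a monomial. -/
theorem IsMonomial.ad_pow {m n : ℤ} {x y : Tilde R} (hx : IsMonomial R m x)
    (hy : IsMonomial R n y) (q : ℕ) :
    IsMonomial R (q * m + n) ((LieAlgebra.ad k (Tilde R) x ^ q) y) := by
  induction q with
  | zero => simpa using hy
  | succ q ih =>
    rw [pow_succ', Module.End.mul_apply, LieAlgebra.ad_apply]
    convert hx.lie ih using 1
    push_cast
    ring

theorem ad_pow_eq_zero_of_le {L : Type*} [LieRing L] [LieAlgebra k L] {x y : L} {m n : ℕ}
    (h : (LieAlgebra.ad k L x ^ m) y = 0) (hmn : m ≤ n) : (LieAlgebra.ad k L x ^ n) y = 0 :=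
  Module.End.pow_map_zero_of_le hmn h

/-- The `p`-th power of `ad (a i)` maps `g̃(A)` to the radical. -/
theorem ad_pow_char_mem_radical [Infinite k] (p : ℕ) [Fact p.Prime] [CharP k p]
    (hA : ∀ i, A i i = 0 ∨ A i i = 2) {a b : Fin θ → Tilde R} {ε : ℤ} (hε : ε ≠ 0)
    (ha : ∀ i, IsMonomial R ε (a i))
    (hab : (∀ i, e R i = a i ∧ f R i = b i) ∨ (∀ i, e R i = b i ∧ f R i = a i))
    (hha : ∀ i z, ∃ c : k, ⁅a i, h R z⁆ = c • a i)
    (hab_ne : ∀ i j, i ≠ j → ⁅a i, b j⁆ = 0)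
    (hab_same : ∀ i, ∃ z, ⁅a i, b i⁆ = h R z ∧ ⁅a i, h R z⁆ = -A i i • a i)
    (hbh : ∀ z j, ∃ c : k, ⁅b j, h R z⁆ = c • b j) (i : Fin θ) (y : Tilde R) :
    (LieAlgebra.ad k (Tilde R) (a i) ^ p) y ∈ radical R := by
  have hp : p.Prime := Fact.out
  set D := LieAlgebra.ad k (Tilde R) (a i) ^ p with hD
  have hDh (z : 𝔥) : D (h R z) = 0 := by
    refine ad_pow_eq_zero_of_le (m := 2) ?_ hp.two_le
    obtain ⟨c, hc⟩ := hha i z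
    simp [pow_two, hc]
  have hDb (j : Fin θ) : D (b j) = 0 := by
    by_cases hij : i = j
    · subst hij
      obtain ⟨z, hz, hz'⟩ := hab_same i
      rcases hp.two_le.eq_or_lt with h2 | h2
      -- For `p = 2` only two brackets are available, and `[a_i, [a_i, b_i]] = -a_ii a_i`; this
      -- vanishes since `2 = 0`.
      · have h0 : A i i = 0 := by
          refine (hA i).elim id fun h => h.trans ?_
          simpa [← h2] using CharP.cast_eq_zero k p
        simp [hD, ← h2, pow_two, hz, hz', h0]
      · exact ad_pow_eq_zero_of_le (m := 3) (by simp [pow_succ, hz, hz']) h2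
    · exact ad_pow_eq_zero_of_le (m := 1) (by simp [hab_ne i j hij]) hp.one_le
  have hDa (j : Fin θ) : D (a j) ∈ radical R := by
    have hba (i j : Fin θ) : ∃ z, ⁅b j, a i⁆ = h R z := by
      by_cases hij : i = j
      · subst hij
        obtain ⟨z, hz, -⟩ := hab_same i
        exact ⟨-z, by rw [h_neg, ← hz, lie_skew]⟩
      · exact ⟨0, by rw [← lie_skew, hab_ne i j hij, neg_zero, ← zero_smul k (0 : 𝔥), h_smul,
          zero_smul]⟩
    refine mem_radical_of_lie_eq_zero ha hab hba hbh ((ha i).ad_pow (ha j) p) ?_ fun l => ?_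
    -- `D (a j)` has degree `pε + ε`, of the same sign as `ε`.
    · have : 0 < ε * ε := mul_self_pos.2 hε
      rw [mul_add, mul_left_comm]
      positivity
    -- `D` kills both `[b_l, a_j] ∈ 𝔥` and `b_l`, so the Leibniz rule leaves `[b_l, D a_j] = 0`.
    · have h₁ := ad_pow_char_lie (k := k) p (a i) (b l) (a j)
      obtain ⟨z, hz⟩ := hba j l
      rw [← hD, hz, hDh, hDb, zero_lie, zero_add] at h₁
      exact h₁.symm
  let S : LieSubalgebra k (Tilde R) :=
    { (radical R).toSubmodule.comap D with
      lie_mem' := fun {y z} hy hz => by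
        change D ⁅y, z⁆ ∈ radical R
        rw [hD, ad_pow_char_lie, ← hD]
        exact add_mem (lie_mem_left k (Tilde R) _ _ _ hy) (lie_mem_right k (Tilde R) _ _ _ hz) }
  have hSa (j : Fin θ) : a j ∈ S := hDa j
  have hSb (j : Fin θ) : b j ∈ S := by
    change D (b j) ∈ radical R
    rw [hDb]
    exact zero_mem _
  have hSh (z : 𝔥) : h R z ∈ S := by
    change D (h R z) ∈ radical R
    rw [hDh]
    exact zero_mem _
  have hS : S = ⊤ := by
    refine subalgebra_eq_top S ?_ ?_ hSh <;> intro i <;> rcases hab with h | h <;>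
      simp only [(h i).1, (h i).2, hSa, hSb]
  have hy : y ∈ S := hS ▸ LieSubalgebra.mem_top y
  exact hy

theorem ad_e_pow_char_mem_radical [Infinite k] (p : ℕ) [Fact p.Prime] [CharP k p]
    (hA : ∀ i, A i i = 0 ∨ A i i = 2) (i : Fin θ) (y : Tilde R) :
    (LieAlgebra.ad k (Tilde R) (e R i) ^ p) y ∈ radical R := by
  have hh (i : Fin θ) (z : 𝔥) : ⁅e R i, h R z⁆ = -R.ξ i z • e R i := by
    rw [← lie_skew, lie_h_e, neg_smul]
  refine ad_pow_char_mem_radical p hA one_ne_zero IsMonomial.e (b := f R)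
    (.inl fun i => ⟨rfl, rfl⟩) (fun i z => ⟨_, hh i z⟩) (fun i j => lie_e_f_ne R)
    (fun i => ⟨_, lie_e_f_same R i, by rw [hh, R.ξ_h]⟩) (fun z j => ⟨R.ξ j z, ?_⟩) i y
  rw [← lie_skew, lie_h_f, neg_smul, neg_neg]

theorem ad_f_pow_char_mem_radical [Infinite k] (p : ℕ) [Fact p.Prime] [CharP k p]
    (hA : ∀ i, A i i = 0 ∨ A i i = 2) (i : Fin θ) (y : Tilde R) :
    (LieAlgebra.ad k (Tilde R) (f R i) ^ p) y ∈ radical R := by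
  have hh (i : Fin θ) (z : 𝔥) : ⁅f R i, h R z⁆ = R.ξ i z • f R i := by
    rw [← lie_skew, lie_h_f, neg_smul, neg_neg]
  refine ad_pow_char_mem_radical p hA (neg_ne_zero.2 one_ne_zero) IsMonomial.f (b := e R)
    (.inr fun i => ⟨rfl, rfl⟩) (fun i z => ⟨_, hh i z⟩) (fun i j hij => ?_)
    -- The signs in `[f_i, e_i] = -h_i` and in the weight `-ξ_i` of `f_i` combine to the same
    -- coefficient `-a_ii` as for `e_i`.
    (fun i => ⟨-R.h i, ?_, ?_⟩) (fun z j => ⟨-R.ξ j z, ?_⟩) i y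
  · rw [← lie_skew, lie_e_f_ne R hij.symm, neg_zero]
  · rw [← lie_skew, lie_e_f_same, h_neg]
  · rw [hh, map_neg, R.ξ_h]
  · rw [← lie_skew, lie_h_e, neg_smul]

end Tilde

/-! ### Passage to `g(A)`. -/

theorem ad_quotient_pow {L : Type*} [LieRing L] [LieAlgebra k L] (I : LieIdeal k L) (x : L) (n : ℕ)
    (hx : ∀ y, (LieAlgebra.ad k L x ^ n) y ∈ I) :
    LieAlgebra.ad k (L ⧸ I) (LieSubmodule.Quotient.mk' I x) ^ n = 0 := by
  have key (m : ℕ) (y : L) :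
      (LieAlgebra.ad k (L ⧸ I) (LieSubmodule.Quotient.mk' I x) ^ m)
          (LieSubmodule.Quotient.mk' I y) =
        LieSubmodule.Quotient.mk' I ((LieAlgebra.ad k L x ^ m) y) := by
    induction m with
    | zero => rfl
    | succ m ih =>
      rw [pow_succ', Module.End.mul_apply, ih, pow_succ', Module.End.mul_apply]
      rfl
  refine LinearMap.ext fun y => ?_
  obtain ⟨y, rfl⟩ := LieSubmodule.Quotient.surjective_mk' I y
  rw [key]
  exact (LieSubmodule.Quotient.mk_eq_zero (N := I)).2 (hx y)

end Contragredient

/-! ### The Lie algebra `(g, x)` in `Rep(α_p)`. -/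

namespace RepAlphaP

variable {k : Type u} [Field k] {p : ℕ} [Fact p.Prime] [CharP k p]

/-- The bracket of a Lie algebra `g` as a morphism of representations of `α_p`. -/
def innerBracket (g : Type u) [LieRing g] [LieAlgebra k g] [Module.Finite k g] (x : g)
    (hx : LieAlgebra.ad k g x ^ p = 0) : ofInner g x hx ⊗ ofInner g x hx ⟶ ofInner g x hx where
  lin := (LieModule.toModuleHom k g g : g ⊗[k] g →ₗ[k] g)
  comm := TensorProduct.ext' fun (y z : g) => by
    change LieModule.toModuleHom k g g (⁅x, y⁆ ⊗ₜ[k] z + y ⊗ₜ[k] ⁅x, z⁆) =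
      ⁅x, LieModule.toModuleHom k g g (y ⊗ₜ[k] z)⁆
    simp only [map_add, LieModule.toModuleHom_apply]
    exact (leibniz_lie x y z).symm

variable (g : Type u) [LieRing g] [LieAlgebra k g] [Module.Finite k g] (x : g)
    (hx : LieAlgebra.ad k g x ^ p = 0)

theorem innerBracket_lin_tmul (y z : g) : (innerBracket g x hx).lin (y ⊗ₜ[k] z) = ⁅y, z⁆ :=
  LieModule.toModuleHom_apply k g g y z

theorem isLieBracket_innerBracket : IsLieBracket (ofInner g x hx) (innerBracket g x hx) where
  antisymm := hom_ext <| TensorProduct.ext' fun (y z : g) => by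
    change LieModule.toModuleHom k g g (y ⊗ₜ[k] z + z ⊗ₜ[k] y) = 0
    rw [map_add, LieModule.toModuleHom_apply, LieModule.toModuleHom_apply, ← lie_skew,
      neg_add_cancel]
  jacobi := hom_ext <| TensorProduct.ext_threefold fun (y z w : g) => by
    change LieModule.toModuleHom k g g ((LieModule.toModuleHom k g g : g ⊗[k] g →ₗ[k] g).rTensor g
      ((y ⊗ₜ[k] z) ⊗ₜ[k] w + (z ⊗ₜ[k] w) ⊗ₜ[k] y + (w ⊗ₜ[k] y) ⊗ₜ[k] z)) = 0
    simp only [map_add, LinearMap.rTensor_tmul, LieModuleHom.coe_toLinearMap,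
      LieModule.toModuleHom_apply]
    -- The categorical identity sums `[[y, z], w]` cyclically; skew symmetry turns it into minus the
    -- right-nested form.
    have := lie_jacobi y z w
    rw [← neg_eq_zero, ← this, ← lie_skew ⁅y, z⁆, ← lie_skew ⁅z, w⁆, ← lie_skew ⁅w, y⁆]
    abel

end RepAlphaP

theorem mainTheorem9 {k : Type u} [Field k] [IsAlgClosed k] (p : ℕ) [Fact p.Prime] [CharP k p]
    {θ : ℕ} (A : Matrix (Fin θ) (Fin θ) k) (hA : ∀ i, A i i = 0 ∨ A i i = 2)
    {𝔥 : Type u} [AddCommGroup 𝔥] [Module k 𝔥] (R : Contragredient.Realization A 𝔥)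
    [Module.Finite k (Contragredient.LieAlg R)] (i : Fin θ) :
    LieAlgebra.ad k (Contragredient.LieAlg R) (Contragredient.f R i) ^ p = 0 ∧
    ∃ he : LieAlgebra.ad k (Contragredient.LieAlg R) (Contragredient.e R i) ^ p = 0,
      ∃ b : RepAlphaP.ofInner (Contragredient.LieAlg R) (Contragredient.e R i) he ⊗
            RepAlphaP.ofInner (Contragredient.LieAlg R) (Contragredient.e R i) he ⟶
          RepAlphaP.ofInner (Contragredient.LieAlg R) (Contragredient.e R i) he,
        IsLieBracket (RepAlphaP.ofInner (Contragredient.LieAlg R) (Contragredient.e R i) he) b ∧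
        ∀ x y : Contragredient.LieAlg R, b.lin (x ⊗ₜ[k] y) = ⁅x, y⁆ := by
  have he := Contragredient.ad_quotient_pow (Contragredient.Tilde.radical R) _ p
    (Contragredient.Tilde.ad_e_pow_char_mem_radical p hA i)
  exact ⟨Contragredient.ad_quotient_pow (Contragredient.Tilde.radical R) _ p
      (Contragredient.Tilde.ad_f_pow_char_mem_radical p hA i), he,
    RepAlphaP.innerBracket _ _ he, RepAlphaP.isLieBracket_innerBracket _ _ he,
    RepAlphaP.innerBracket_lin_tmul _ _ he⟩
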